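/- All graphs are finite, simple and undirected, and the spectrum of a graph is the multiset of eigenvalues (with multiplicities) of its adjacency matrix. For an integer $k\ge 2$, let $\mathcal{H}_{k,k+1}$ be the graph on $2k+1$ vertices obtained from the complete bipartite graph $K_{k,k}$ by deleting the edges of a perfect matching and then adding one new vertex joined to all the vertices of one of the two parts (and to no other vertex). Then for every $k\ge 2$ the graph $\mathcal{H}_{k,k+1}$ is determined by its spectrum (DS): every graph, connected or not, that has the same spectrum as $\mathcal{H}_{k,k+1}$ is isomorphic to $\mathcal{H}_{k,k+1}$. -/

import Mathlib

universe u

/-- The spectrum of a finite graph: the multiset of eigenvalues of its adjacency matrix, that is,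
of the roots, with multiplicity, of the characteristic polynomial of that matrix. -/
noncomputable def graphSpectrum {V : Type*} [Fintype V] (G : SimpleGraph V) : Multiset ℝ := by
  classical exact (G.adjMatrix ℝ).charpoly.roots

/-- `G` is determined by its spectrum: every finite simple graph with the same spectrum as `G` is
isomorphic to `G`. -/
def IsDS.{v, w} {V : Type v} [Fintype V] (G : SimpleGraph V) : Prop :=
  ∀ (W : Type w) [Fintype W] (H : SimpleGraph W),
    graphSpectrum H = graphSpectrum G → Nonempty (H ≃g G)

/-- The complete bipartite graph `K_{k,k}` minus the perfect matching that joins, for each `i`, the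
`i`-th vertices of the two parts. -/
def graphL (k : ℕ) : SimpleGraph (Fin k ⊕ Fin k) :=
  (completeBipartiteGraph (Fin k) (Fin k)).deleteEdges
    (Set.range fun i : Fin k => s(Sum.inl i, Sum.inr i))

/-- The graph obtained from `graphL k` by adding a new vertex `none` and joining it to all the
vertices of one part. -/
def graphH (k : ℕ) : SimpleGraph (Option (Fin k ⊕ Fin k)) :=
  (graphL k).map some ⊔
    SimpleGraph.fromEdgeSet (Set.range fun i : Fin k => s(none, some (Sum.inl i)))

/-! The target is bipartite with parts of sizes `k` and `k + 1`, and its biadjacency matrix `N`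
satisfies `N Nᵀ = 1 + (k - 1) J`, where `J` is all ones. This is nonsingular. A cospectral graph has
no odd closed walks, so it is bipartite, with some biadjacency matrix `M`. Comparing characteristic
polynomials of squared adjacency matrices gives the part sizes and makes `M Mᵀ` similar to `N Nᵀ`.
Hence `M Mᵀ - 1` has rank one. Its vanishing 2×2 minors say `(dᵢ - 1)(dⱼ - 1) = |Sᵢ ∩ Sⱼ|²` for the
neighbourhoods `Sᵢ` of size `dᵢ`, and the trace gives `∑ dᵢ = k²`. Counting
(`card_eq_of_sq_card_inter`) forces every `dᵢ = k`; then the `Sᵢ` are complements of distinct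
points, which is the target graph. -/

/-- The graph on `P ⊕ Q` whose edges join the related elements of `P` and `Q`. -/
def relGraph {P Q : Type*} (r : P → Q → Prop) : SimpleGraph (P ⊕ Q) where
  Adj
    | .inl i, .inr j => r i j
    | .inr j, .inl i => r i j
    | _, _ => False
  symm := ⟨by rintro (i | i) (j | j) h <;> exact h⟩
  loopless := ⟨by rintro (i | i) h <;> exact h⟩

/-- Exchanging the parts of a bipartite graph. -/
def relGraphSwap {P Q : Type*} (r : P → Q → Prop) : relGraph r ≃g relGraph (fun j i => r i j) where
  toEquiv := Equiv.sumComm P Q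
  map_rel_iff' := by rintro (i | i) (j | j) <;> rfl

/-- Relabelling the parts of a bipartite graph. -/
def relGraphCongr {P Q P' Q' : Type*} {r : P → Q → Prop} {r' : P' → Q' → Prop} (e : P ≃ P')
    (f : Q ≃ Q') (h : ∀ i j, r i j ↔ r' (e i) (f j)) : relGraph r ≃g relGraph r' where
  toEquiv := e.sumCongr f
  map_rel_iff' := by rintro (i | i) (j | j) <;> first | exact (h _ _).symm | rfl

/-- The relation "`j` is not `i`" between `Fin k` and its extension by one point. -/
def neRel (k : ℕ) (i : Fin k) (j : Option (Fin k)) : Prop := j ≠ some i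

/-- `graphH k` as a bipartite graph with parts of sizes `k` and `k + 1`. -/
def graphHIso (k : ℕ) : relGraph (neRel k) ≃g graphH k where
  toFun := Sum.elim (fun i => some (.inl i)) (fun j => j.map .inr)
  invFun := fun x => x.elim (.inr none) (Sum.elim .inl (fun j => .inr (some j)))
  left_inv := by rintro (i | (_ | j)) <;> rfl
  right_inv := by rintro (_ | (i | j)) <;> rfl
  map_rel_iff' := by
    have hmap : ∀ x y, ((graphL k).map some).Adj x y ↔
        ∃ u v, (graphL k).Adj u v ∧ some u = x ∧ some v = y :=
      SimpleGraph.map_adj Function.Embedding.some _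
    rintro (i | (_ | i)) (j | (_ | j)) <;>
      simp [graphH, hmap] <;> simp [graphL, relGraph, neRel, eq_comm]

theorem exists_iso_relGraph {V : Type*} (G : SimpleGraph V) (hG : G.Colorable 2) :
    ∃ (s : Set V) (r : s → (sᶜ : Set V) → Prop), Nonempty (G ≃g relGraph r) := by
  classical
  obtain ⟨c⟩ := hG
  have hc : ∀ x y : V, G.Adj x y → (c x = 0 ↔ ¬ c y = 0) := fun x y h => by
    have := c.valid h
    grind
  refine ⟨{x | c x = 0}, fun i j => G.Adj i j, ⟨RelIso.symm ⟨Equiv.Set.sumCompl _, ?_⟩⟩⟩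
  rintro (⟨i, hi⟩ | ⟨i, hi⟩) (⟨j, hj⟩ | ⟨j, hj⟩)
  · simp only [Equiv.Set.sumCompl_apply_inl]
    exact ⟨fun h => ((hc _ _ h).1 hi hj).elim, False.elim⟩
  · simp [relGraph]
  · simp [relGraph, G.adj_comm]
  · simp only [Equiv.Set.sumCompl_apply_inr]
    exact ⟨fun h => hi ((hc _ _ h).2 hj), False.elim⟩

theorem relGraph_colorable {P Q : Type*} (r : P → Q → Prop) : (relGraph r).Colorable 2 :=
  ⟨SimpleGraph.Coloring.mk (Sum.elim (fun _ => 0) (fun _ => 1)) (by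
    rintro (i | i) (j | j) h <;> simp_all [relGraph])⟩

/-! ### Set systems satisfying the minor equations -/

open Finset in
-- Sizes 0 and 1 make the total too small. Two distinct sizes must be 2 and 5, which leaves only `k
-- = 4` to exclude, by a congruence mod 3.
theorem card_eq_of_sq_card_inter {P Q : Type*} [Fintype P] [Fintype Q] [DecidableEq Q] {k : ℕ}
    (hk : 2 ≤ k) (hP : Fintype.card P = k) (hQ : Fintype.card Q = k + 1) (S : P → Finset Q)
    (hS : ∀ i j, i ≠ j → ((#(S i) : ℤ) - 1) * ((#(S j) : ℤ) - 1) = (#(S i ∩ S j) : ℤ) ^ 2)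
    (hsum : ∑ i, #(S i) = k ^ 2) (i : P) : #(S i) = k := by
  classical
  have hle : ∀ i, #(S i) ≤ k + 1 := fun i => hQ ▸ card_le_univ _
  have key : ∀ i B, #(S i) ≤ B → (∀ j, j ≠ i → #(S j) ≤ k) → k ^ 2 ≤ B + (k - 1) * k := by
    intro i B hi h
    rw [← hsum, ← add_sum_erase _ _ (mem_univ i)]
    refine add_le_add hi ((sum_le_card_nsmul _ _ k fun j hj => h j (ne_of_mem_erase hj)).trans ?_)
    simp [card_erase_of_mem, hP]
  obtain ⟨n, rfl⟩ : ∃ n, k = n + 2 := ⟨k - 2, by omega⟩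
  have h0 : ∀ i, #(S i) ≠ 0 := by
    intro i hi
    have := key i 0 hi.le fun j hj => by
      have := hS i j hj.symm
      rw [hi] at this
      push_cast at this
      nlinarith [sq_nonneg (#(S i ∩ S j) : ℤ)]
    simp at this
    nlinarith
  have h1 : ∀ i, #(S i) ≠ 1 := by
    intro i hi
    have := key i 1 hi.le fun j hj => by
      have := hS i j hj.symm
      have h2 : #(S i ∩ S j) = 0 := by simpa [hi, -card_eq_zero] using this.symm
      have h3 := card_union_add_card_inter (S i) (S j)
      have h4 := card_le_univ (S i ∪ S j)
      omega
    simp at this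
    nlinarith
  have hlt : ∀ i j, #(S i) < #(S j) → #(S i) = 2 ∧ #(S j) = 5 := by
    intro i j hij
    have hne : i ≠ j := by rintro rfl; exact lt_irrefl _ hij
    have h2 := hS i j hne
    have h3 : #(S i ∩ S j) ≤ #(S i) := card_le_card inter_subset_left
    obtain ⟨a, ha⟩ : ∃ a, #(S i) = a + 2 := ⟨#(S i) - 2, by have := h0 i; have := h1 i; omega⟩
    obtain ⟨b, hb⟩ : ∃ b, #(S j) = a + 3 + b := ⟨#(S j) - (a + 3), by omega⟩
    rw [ha, hb] at h2
    rw [ha] at h3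
    -- A smaller intersection would have square at most `(a + 1)²`, less than the product. So `S i ⊆
    -- S j`.
    have h4 : #(S i ∩ S j) = a + 2 := by
      refine le_antisymm h3 ?_
      by_contra hc
      have : (#(S i ∩ S j) : ℤ) ≤ a + 1 := by omega
      push_cast at h2
      nlinarith
    rw [h4] at h2
    push_cast at h2
    have h5 : (a + 1) * b = a + 2 := by zify; linarith
    have hb1 : b ≠ 0 := by rintro rfl; omega
    have hb2 : b ≠ 1 := by rintro rfl; omega
    have ha0 : a = 0 := by
      by_contra h
      have : 2 ≤ b := by omega
      have := Nat.mul_le_mul_left (a + 1) this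
      omega
    subst ha0
    omega
  have hall : ∀ i, #(S i) ≤ n + 2 := by
    by_contra! hc
    obtain ⟨j, hj⟩ := hc
    -- The average size is `k`, so a larger set forces a smaller one.
    have hex : ∃ i, #(S i) < n + 2 := by
      by_contra! hc
      have : ∑ i : P, (n + 2) < ∑ i, #(S i) :=
        sum_lt_sum (fun i _ => hc i) ⟨j, mem_univ _, hj⟩
      simp [hP, hsum, sq] at this
    obtain ⟨i, hi⟩ := hex
    have h5 := hlt i j (by omega)
    have hn : n = 2 := by have := hle j; omega
    -- Now `k = 4` and every size is 2 or 5, so the sum is 2 mod 3, whereas `k² = 16` is 1 mod 3.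
    have hmod : ∀ l, ∃ b, #(S l) = 2 + 3 * b := by
      intro l
      rcases lt_or_ge #(S l) #(S j) with h | h
      · exact ⟨0, (hlt l j h).1⟩
      · exact ⟨1, by have := hle l; omega⟩
    choose b hb using hmod
    simp only [hb, sum_add_distrib, ← mul_sum, sum_const, card_univ, hP, hn] at hsum
    simp at hsum
    omega
  refine (sum_eq_sum_iff_of_le (fun i _ => hall i)).1 ?_ i (mem_univ i)
  simp [hsum, hP, sq]

open Finset in
theorem exists_equiv_neRel {P Q : Type*} [Fintype P] [Fintype Q] [DecidableEq Q] {k : ℕ}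
    (hk : 2 ≤ k) (hP : Fintype.card P = k) (hQ : Fintype.card Q = k + 1) (S : P → Finset Q)
    (hS : ∀ i j, i ≠ j → ((#(S i) : ℤ) - 1) * ((#(S j) : ℤ) - 1) = (#(S i ∩ S j) : ℤ) ^ 2)
    (hsum : ∑ i, #(S i) = k ^ 2) :
    ∃ (e : P ≃ Fin k) (f : Q ≃ Option (Fin k)), ∀ i j, j ∈ S i ↔ neRel k (e i) (f j) := by
  classical
  have hd := card_eq_of_sq_card_inter hk hP hQ S hS hsum
  have hm : ∀ i, ∃ m, (S i)ᶜ = {m} := fun i => by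
    rw [← card_eq_one, card_compl, hQ, hd]; omega
  choose m hm using hm
  have hmem : ∀ i j, j ∈ S i ↔ j ≠ m i := fun i j => by
    rw [ne_eq, ← mem_singleton, ← hm, mem_compl, not_not]
  have hinj : Function.Injective m := by
    intro i j hij
    -- Equal sets of size `k` would give `(k - 1)² = k²`.
    by_contra hne
    have hSS : S i = S j := by ext x; rw [hmem, hmem, hij]
    have := hS i j hne
    rw [hSS, inter_self, hd] at this
    have : (2 : ℤ) ≤ k := by exact_mod_cast hk
    linarith
  obtain ⟨q, hq⟩ : ∃ q, ∀ i, m i ≠ q := by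
    by_contra! hc
    have := Fintype.card_le_of_surjective m hc
    omega
  let e : P ≃ Fin k := Fintype.equivFinOfCardEq hP
  let g : Option (Fin k) → Q := fun x => x.elim q fun i => m (e.symm i)
  have hg : Function.Bijective g := by
    rw [Fintype.bijective_iff_injective_and_card]
    refine ⟨?_, by simp [hQ]⟩
    rintro (_ | i) (_ | j) h
    · rfl
    · exact (hq _ h.symm).elim
    · exact (hq _ h).elim
    · exact congrArg some (e.symm.injective (hinj h))
  refine ⟨e, (Equiv.ofBijective g hg).symm, fun i j => ?_⟩
  rw [hmem, neRel, ne_eq, ne_eq, Equiv.symm_apply_eq]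
  simp [g]

/-! ### Similarity of symmetric matrices with equal characteristic polynomials -/

open Matrix in
-- Both matrices diagonalise orthogonally to the same eigenvalue list. `U` and `V` are rectangular
-- in type because the index types differ.
theorem exists_conj_of_charpoly_eq {n m : Type*} [Fintype n] [Fintype m] [DecidableEq n]
    [DecidableEq m] {A : Matrix n n ℝ} {B : Matrix m m ℝ} (hA : A.IsHermitian)
    (hB : B.IsHermitian) (h : A.charpoly = B.charpoly) :
    ∃ (U : Matrix n m ℝ) (V : Matrix m n ℝ), U * V = 1 ∧ V * U = 1 ∧ A = U * B * V := by
  have hcard : Fintype.card n = Fintype.card m := by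
    simpa [charpoly_natDegree_eq_dim] using congrArg Polynomial.natDegree h
  let e := Fintype.equivOfCardEq hcard
  have hB' : (B.submatrix e e).IsHermitian := hB.submatrix e
  have hch : A.charpoly = (B.submatrix e e).charpoly := by
    rw [h]
    exact (charpoly_reindex e.symm B).symm
  have hev := (hA.eigenvalues_eq_eigenvalues_iff hB').2 hch
  have h1 := hA.spectral_theorem
  have h2 := hB'.conjStarAlgAut_star_eigenvectorUnitary
  rw [hev, ← h2, Unitary.conjStarAlgAut_apply, Unitary.conjStarAlgAut_apply] at h1
  set W := hA.eigenvectorUnitary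
  set Z := hB'.eigenvectorUnitary
  have hB2 : B.submatrix e e = (1 : Matrix m m ℝ).submatrix e id * B * (1 : Matrix m m ℝ).submatrix id e := by
    ext i j
    simp [Matrix.mul_apply, Matrix.one_apply]
  have he1 : (1 : Matrix m m ℝ).submatrix e id * (1 : Matrix m m ℝ).submatrix id e = 1 := by
    ext i j
    simp [Matrix.mul_apply, Matrix.one_apply]
  have he2 : (1 : Matrix m m ℝ).submatrix id e * (1 : Matrix m m ℝ).submatrix e id = 1 := by
    rw [submatrix_mul_equiv]; simp
  have hW1 : (W : Matrix n n ℝ) * star (W : Matrix n n ℝ) = 1 := Unitary.mul_star_self_of_mem W.2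
  have hW2 : star (W : Matrix n n ℝ) * (W : Matrix n n ℝ) = 1 := Unitary.star_mul_self_of_mem W.2
  have hZ1 : (Z : Matrix n n ℝ) * star (Z : Matrix n n ℝ) = 1 := Unitary.mul_star_self_of_mem Z.2
  have hZ2 : star (Z : Matrix n n ℝ) * (Z : Matrix n n ℝ) = 1 := Unitary.star_mul_self_of_mem Z.2
  refine ⟨(W : Matrix n n ℝ) * star (Z : Matrix n n ℝ) * (1 : Matrix m m ℝ).submatrix e id,
    (1 : Matrix m m ℝ).submatrix id e * (Z : Matrix n n ℝ) * star (W : Matrix n n ℝ), ?_, ?_, ?_⟩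
  · calc _ = (W : Matrix n n ℝ) * (star (Z : Matrix n n ℝ) * (((1 : Matrix m m ℝ).submatrix e id *
            (1 : Matrix m m ℝ).submatrix id e) * (Z : Matrix n n ℝ))) * star (W : Matrix n n ℝ) := by
          simp only [Matrix.mul_assoc]
      _ = 1 := by rw [he1, Matrix.one_mul, hZ2, Matrix.mul_one, hW1]
  · calc _ = (1 : Matrix m m ℝ).submatrix id e * ((Z : Matrix n n ℝ) * ((star (W : Matrix n n ℝ) * (W : Matrix n n ℝ)) *
            star (Z : Matrix n n ℝ))) * (1 : Matrix m m ℝ).submatrix e id := by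
          simp only [Matrix.mul_assoc]
      _ = 1 := by rw [hW2, Matrix.one_mul, hZ1, Matrix.mul_one, he2]
  · rw [hB2] at h1
    simpa [Matrix.mul_assoc] using h1

section conj
open Matrix
variable {n m : Type*} [Fintype n] [Fintype m] [DecidableEq n] [DecidableEq m]
  {B : Matrix m m ℝ} {U : Matrix n m ℝ} {V : Matrix m n ℝ}

theorem conj_pow_eq (hUV : U * V = 1) (hVU : V * U = 1) (j : ℕ) :
    (U * B * V) ^ j = U * B ^ j * V := by
  induction j with
  | zero => simp [hUV]
  | succ j ih =>
    rw [pow_succ, ih, pow_succ]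
    calc _ = U * B ^ j * (V * U) * B * V := by simp only [Matrix.mul_assoc]
      _ = _ := by rw [hVU]; simp only [Matrix.mul_assoc, Matrix.one_mul]

omit [DecidableEq n] in
theorem trace_conj_eq (hVU : V * U = 1) : (U * B * V).trace = B.trace := by
  rw [Matrix.trace_mul_comm, ← Matrix.mul_assoc, hVU, Matrix.one_mul]

theorem charpoly_conj_eq (hUV : U * V = 1) (hVU : V * U = 1) :
    (U * B * V).charpoly = B.charpoly := by
  have hcard : Fintype.card n = Fintype.card m := by
    have h1 := congrArg Matrix.trace hUV
    rw [Matrix.trace_mul_comm, hVU] at h1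
    simpa using h1.symm
  have h := charpoly_mul_comm' (U * B) V
  rw [hcard, ← Matrix.mul_assoc, hVU, Matrix.one_mul] at h
  exact mul_left_cancel₀ (pow_ne_zero _ Polynomial.X_ne_zero) h

end conj

/-! ### Graph spectra and bipartiteness -/

theorem adjMatrix_isHermitian {V : Type*} (G : SimpleGraph V) [DecidableRel G.Adj] :
    (G.adjMatrix ℝ).IsHermitian :=
  G.isSymm_adjMatrix (α := ℝ)

theorem charpoly_adjMatrix_eq_of_graphSpectrum_eq {V W : Type*} [Fintype V] [Fintype W]
    [DecidableEq V] [DecidableEq W] {G : SimpleGraph V} {H : SimpleGraph W} [DecidableRel G.Adj]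
    [DecidableRel H.Adj] (h : graphSpectrum G = graphSpectrum H) :
    (G.adjMatrix ℝ).charpoly = (H.adjMatrix ℝ).charpoly := by
  have hroots : (G.adjMatrix ℝ).charpoly.roots = (H.adjMatrix ℝ).charpoly.roots := by
    unfold graphSpectrum at h
    convert h
  rw [(adjMatrix_isHermitian G).splits_charpoly.eq_prod_roots_of_monic (Matrix.charpoly_monic _),
    (adjMatrix_isHermitian H).splits_charpoly.eq_prod_roots_of_monic (Matrix.charpoly_monic _),
    hroots]

open Classical in
theorem graphSpectrum_congr {V W : Type*} [Fintype V] [Fintype W]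
    {G : SimpleGraph V} {H : SimpleGraph W} (e : G ≃g H) : graphSpectrum G = graphSpectrum H := by
  unfold graphSpectrum
  rw [← Matrix.charpoly_reindex e.toEquiv]
  congr 2
  ext i j
  simp only [Matrix.reindex_apply, Matrix.submatrix_apply, SimpleGraph.adjMatrix_apply,
    ← e.symm.map_adj_iff]
  rfl

open Classical in
/-- A graph with the same spectrum as a bipartite graph is bipartite. -/
theorem colorable_two_of_graphSpectrum_eq {V W : Type*} [Fintype V] [Fintype W]
    {G : SimpleGraph V} {H : SimpleGraph W} (h : graphSpectrum G = graphSpectrum H)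
    (hH : H.Colorable 2) : G.Colorable 2 := by
  obtain ⟨U, V', hUV, hVU, hG⟩ := exists_conj_of_charpoly_eq (adjMatrix_isHermitian G)
    (adjMatrix_isHermitian H) (charpoly_adjMatrix_eq_of_graphSpectrum_eq h)
  rw [SimpleGraph.two_colorable_iff_forall_loop_even] at hH ⊢
  intro u w
  by_contra hodd
  -- The trace of the `l`-th power counts closed walks of length `l`, and similarity preserves it.
  have h0 : (H.adjMatrix ℝ ^ w.length).trace = 0 := by
    refine Finset.sum_eq_zero fun x _ => ?_
    rw [Matrix.diag_apply, SimpleGraph.adjMatrix_pow_apply_eq_card_walk, Nat.cast_eq_zero,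
      Fintype.card_eq_zero_iff]
    refine ⟨fun p => hodd ?_⟩
    have := hH x p.1
    rwa [p.2] at this
  rw [← trace_conj_eq hVU, ← conj_pow_eq hUV hVU, ← hG] at h0
  have h1 := (Finset.sum_eq_zero_iff_of_nonneg (fun x _ => by
    rw [Matrix.diag_apply, SimpleGraph.adjMatrix_pow_apply_eq_card_walk]
    positivity)).1 h0 u (Finset.mem_univ u)
  rw [Matrix.diag_apply, SimpleGraph.adjMatrix_pow_apply_eq_card_walk, Nat.cast_eq_zero,
    Fintype.card_eq_zero_iff] at h1
  exact h1.false ⟨w, rfl⟩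

/-! ### Biadjacency matrices -/

open Classical in
/-- The biadjacency matrix of a relation. -/
noncomputable def biadj {P Q : Type*} (r : P → Q → Prop) : Matrix P Q ℝ :=
  Matrix.of fun i j => if r i j then 1 else 0

open Classical in
theorem adjMatrix_relGraph {P Q : Type*} (r : P → Q → Prop) :
    (relGraph r).adjMatrix ℝ = Matrix.fromBlocks 0 (biadj r) (biadj r).transpose 0 := by
  ext (i | i) (j | j) <;> rw [SimpleGraph.adjMatrix_apply] <;> simp [relGraph, biadj] <;> rfl

open Classical Polynomial in
theorem charpoly_sq_adjMatrix_relGraph {P Q : Type*} [Fintype P] [Fintype Q] [DecidableEq P]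
    [DecidableEq Q] (r : P → Q → Prop) (hPQ : Fintype.card P ≤ Fintype.card Q) :
    ((relGraph r).adjMatrix ℝ ^ 2).charpoly = X ^ (Fintype.card Q - Fintype.card P) *
      (biadj r * (biadj r).transpose).charpoly ^ 2 := by
  rw [adjMatrix_relGraph, sq, Matrix.fromBlocks_multiply]
  simp only [Matrix.zero_mul, Matrix.mul_zero, zero_add, add_zero]
  rw [Matrix.charpoly_fromBlocks_zero₁₂, Matrix.charpoly_mul_comm_of_le _ _ hPQ]
  ring

open Polynomial in
-- As `g` does not vanish at 0, the right side has a simple root there, so `m = 1`. Monicity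
-- excludes `f = -g`.
theorem eq_of_X_pow_mul_sq_eq {f g : ℝ[X]} {m : ℕ} (hf : f.Monic) (hg : g.Monic)
    (hg0 : g.eval 0 ≠ 0) (hm : m ≠ 0) (h : X ^ m * f ^ 2 = X ^ 1 * g ^ 2) : m = 1 ∧ f = g := by
  obtain ⟨m, rfl⟩ := Nat.exists_eq_succ_of_ne_zero hm
  rw [Nat.succ_eq_add_one, pow_add, mul_comm (X ^ m), mul_assoc] at h
  have h1 := mul_left_cancel₀ (pow_ne_zero 1 X_ne_zero) h
  have hm0 : m = 0 := by
    by_contra hm0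
    have := congrArg (eval 0) h1
    simp [hm0] at this
    exact hg0 (pow_eq_zero_iff two_ne_zero |>.1 this.symm)
  subst hm0
  refine ⟨rfl, ?_⟩
  rw [pow_zero, one_mul] at h1
  rcases sq_eq_sq_iff_eq_or_eq_neg.1 h1 with h2 | h2
  · exact h2
  · have := congrArg leadingCoeff h2
    rw [leadingCoeff_neg, hf.leadingCoeff, hg.leadingCoeff] at this
    norm_num at this

open Matrix in
theorem biadj_neRel_mul_transpose (k : ℕ) :
    biadj (neRel k) * (biadj (neRel k)).transpose =
      1 + ((k : ℝ) - 1) • vecMulVec (fun _ => 1) (fun _ => 1) := by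
  classical
  ext i j
  have h : ∀ a b : Fin k, (∑ x : Fin k, if x = a ∨ x = b then (0 : ℝ) else 1) =
      k - 2 + if a = b then 1 else 0 := by
    intro a b
    -- Inclusion–exclusion; the last term corrects the double subtraction when `a = b`.
    have : ∀ x : Fin k, (if x = a ∨ x = b then (0 : ℝ) else 1) = 1 - (if x = a then 1 else 0) -
        (if x = b then 1 else 0) + if x = a then (if a = b then 1 else 0) else 0 := by
      intro x
      split_ifs <;> grind
    simp only [this, Finset.sum_add_distrib, Finset.sum_sub_distrib]
    simp
    ring
  have h2 : ∀ x : Fin k, ((if x = j then (0 : ℝ) else if x = i then 0 else 1)) =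
      if x = i ∨ x = j then 0 else 1 := by
    intro x; split_ifs <;> grind
  simp [biadj, neRel, Matrix.mul_apply, vecMulVec_apply, Matrix.one_apply, h2, h]
  split_ifs <;> ring

open Matrix in
theorem eval_charpoly_biadj_neRel_ne_zero {k : ℕ} (hk : 1 ≤ k) :
    (biadj (neRel k) * (biadj (neRel k)).transpose).charpoly.eval 0 ≠ 0 := by
  rw [biadj_neRel_mul_transpose, eval_charpoly, map_zero, zero_sub, det_neg]
  have h : (1 + ((k : ℝ) - 1) • vecMulVec (fun _ => 1) (fun _ => 1) :
      Matrix (Fin k) (Fin k) ℝ).PosDef := by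
    refine PosDef.one.add_posSemidef (PosSemidef.smul ?_ ?_)
    · simpa using posSemidef_vecMulVec_self_star (fun _ : Fin k => (1 : ℝ))
    · have : (1 : ℝ) ≤ k := by exact_mod_cast hk
      linarith
  exact mul_ne_zero (pow_ne_zero _ (by norm_num)) h.det_pos.ne'

open Classical Finset in
theorem biadj_mul_transpose_apply {P Q : Type*} [Fintype Q] (r : P → Q → Prop) (i j : P) :
    (biadj r * (biadj r).transpose) i j = #(({x | r i x} : Finset Q) ∩ ({x | r j x} : Finset Q)) := by
  rw [← filter_and, card_filter]
  push_cast
  rw [Matrix.mul_apply]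
  refine sum_congr rfl fun x _ => ?_
  by_cases h1 : r i x <;> by_cases h2 : r j x <;> simp [biadj, h1, h2]

open Classical Matrix Finset in
theorem exists_iso_of_graphSpectrum_eq {P Q : Type*} [Fintype P] [Fintype Q] (r : P → Q → Prop)
    {k : ℕ} (hk : 2 ≤ k) (hPQ : Fintype.card P ≤ Fintype.card Q)
    (h : graphSpectrum (relGraph r) = graphSpectrum (relGraph (neRel k))) :
    Nonempty (relGraph r ≃g relGraph (neRel k)) := by
  have hch := charpoly_adjMatrix_eq_of_graphSpectrum_eq h
  have hcard : Fintype.card P + Fintype.card Q = 2 * k + 1 := by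
    have := congrArg Polynomial.natDegree hch
    simp only [charpoly_natDegree_eq_dim, Fintype.card_sum, Fintype.card_option,
      Fintype.card_fin] at this
    omega
  obtain ⟨U, V, hUV, hVU, hA⟩ := exists_conj_of_charpoly_eq
    (adjMatrix_isHermitian (relGraph r)) (adjMatrix_isHermitian (relGraph (neRel k))) hch
  have hsq : ((relGraph r).adjMatrix ℝ ^ 2).charpoly =
      ((relGraph (neRel k)).adjMatrix ℝ ^ 2).charpoly := by
    rw [hA, conj_pow_eq hUV hVU, charpoly_conj_eq hUV hVU]
  rw [charpoly_sq_adjMatrix_relGraph r hPQ, charpoly_sq_adjMatrix_relGraph _ (by simp)] at hsq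
  have hone : Fintype.card (Option (Fin k)) - Fintype.card (Fin k) = 1 := by simp
  rw [hone] at hsq
  -- The part sizes differ because their sum `2 * k + 1` is odd.
  obtain ⟨hm, hfg⟩ := eq_of_X_pow_mul_sq_eq (charpoly_monic _) (charpoly_monic _)
    (eval_charpoly_biadj_neRel_ne_zero (by omega)) (by omega) hsq
  obtain ⟨U, V, hUV, hVU, hM⟩ := exists_conj_of_charpoly_eq
    (isHermitian_mul_conjTranspose_self (biadj r))
    (isHermitian_mul_conjTranspose_self (biadj (neRel k))) hfg
  simp only [conjTranspose_eq_transpose_of_trivial] at hM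
  have htr := trace_conj_eq (B := biadj (neRel k) * (biadj (neRel k)).transpose) hVU
  rw [← hM, biadj_neRel_mul_transpose] at htr
  -- Conjugation fixes the identity and keeps the other summand a multiple of an outer product.
  rw [biadj_neRel_mul_transpose, Matrix.mul_add, Matrix.add_mul, Matrix.mul_one, hUV,
    Matrix.mul_smul, mul_vecMulVec, Matrix.smul_mul, vecMulVec_mul] at hM
  set S : P → Finset Q := fun i => {x | r i x}
  have hent : ∀ i j, (biadj r * (biadj r).transpose) i j = #(S i ∩ S j) :=
    biadj_mul_transpose_apply r
  have hminor : ∀ i j, i ≠ j →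
      ((#(S i) : ℤ) - 1) * ((#(S j) : ℤ) - 1) = (#(S i ∩ S j) : ℤ) ^ 2 := by
    intro i j hij
    have hii := hent i i
    have hjj := hent j j
    have hi := hent i j
    have hj := hent j i
    rw [inter_comm] at hj
    rw [inter_self] at hii hjj
    rw [hM] at hii hjj hi hj
    simp only [Matrix.add_apply, Matrix.smul_apply, vecMulVec_apply, one_apply_eq, smul_eq_mul,
      one_apply_ne hij, one_apply_ne hij.symm, zero_add] at hii hjj hi hj
    have : ((#(S i) : ℝ) - 1) * ((#(S j) : ℝ) - 1) = (#(S i ∩ S j) : ℝ) ^ 2 := by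
      rw [sq]
      nth_rewrite 1 [← hi]
      rw [← hj, ← hii, ← hjj]
      ring
    exact_mod_cast this
  have hsum : ∑ i, #(S i) = k ^ 2 := by
    have : (∑ i, #(S i) : ℝ) = (k : ℝ) ^ 2 := by
      calc (∑ i, #(S i) : ℝ) = (biadj r * (biadj r).transpose).trace :=
            sum_congr rfl fun i _ => by rw [diag_apply, hent, inter_self]
        _ = _ := by
          rw [htr, trace_add, trace_smul, trace_vecMulVec]
          simp [dotProduct]
          ring
    exact_mod_cast this
  obtain ⟨e, f, hef⟩ := exists_equiv_neRel hk (by omega) (by omega) S hminor hsum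
  exact ⟨relGraphCongr e f fun i j => by rw [← hef]; simp [S]⟩

theorem mainTheorem5 (k : ℕ) (hk : 2 ≤ k) : IsDS.{0, u} (graphH k) := by
  classical
  intro W _ H hspec
  rw [← graphSpectrum_congr (graphHIso k)] at hspec
  have hcol := colorable_two_of_graphSpectrum_eq hspec (relGraph_colorable _)
  obtain ⟨s, r, ⟨e⟩⟩ := exists_iso_relGraph H hcol
  rw [graphSpectrum_congr e] at hspec
  rcases le_total (Fintype.card s) (Fintype.card (sᶜ : Set W)) with hle | hle
  · obtain ⟨f⟩ := exists_iso_of_graphSpectrum_eq r hk hle hspec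
    exact ⟨(e.trans f).trans (graphHIso k)⟩
  · rw [graphSpectrum_congr (relGraphSwap r)] at hspec
    obtain ⟨f⟩ := exists_iso_of_graphSpectrum_eq _ hk hle hspec
    exact ⟨((e.trans (relGraphSwap r)).trans f).trans (graphHIso k)⟩
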